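/- Let $G$ be a finite group with a homomorphism $s: G\to\{1,-1\}$; the elements with $s(g)=-1$ are called anti-unitary (there may be none). Put $\kappa_{1}=\mathrm{id}$ and let $\kappa_{-1}=\kappa$ be complex conjugation. Let $\omega: G\times G\to U(1)$ be a factor system, i.e. $\omega(g_1,g_2)\,\omega(g_1g_2,g_3)=\omega(g_2,g_3)^{s(g_1)}\,\omega(g_1,g_2g_3)$ for all $g_1,g_2,g_3\in G$. A unitary projective (co-)representation of $G$ of dimension $n$ with factor system $\omega$ is a family of unitary $n\times n$ matrices $M(g)$, $g\in G$, with $M(g_1)\kappa_{s(g_1)}M(g_2)\kappa_{s(g_2)}=\omega(g_1,g_2)\,M(g_1g_2)\kappa_{s(g_1g_2)}$ as operators on $\mathbb C^n$. It is irreducible if $n\ge 1$ and the only complex subspaces of $\mathbb C^n$ invariant under all operators $M(g)\kappa_{s(g)}$ are $0$ and $\mathbb C^n$. Let $M$ be such a (co-)representation, of dimension $d$. For a complex $d\times d$ matrix $X$ let $$\mathscr H_X=\sum_{g\in G}\big[M(g)\kappa_{s(g)}\big]\,(X+X^\dagger)\,\big[M(g)\kappa_{s(g)}\big]^{-1}.$$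 (1) For every $X$, the matrix $\mathscr H_X$ is Hermitian and commutes with every operator $M(g)\kappa_{s(g)}$, $g\in G$. (2) For all $X\in\mathbb C^{d\times d}$ outside a set of Lebesgue measure zero, the following holds. For every eigenvalue $\mu$ of $\mathscr H_X$ and every orthonormal basis $b_1,\dots,b_k$ of the corresponding eigenspace, there is an irreducible unitary projective (co-)representation $N$ of $G$ of dimension $k$, with the same factor system $\omega$, such that $M(g)\kappa_{s(g)}\,b_j=\sum_{i=1}^k N(g)_{ij}\,b_i$ for all $g\in G$ and $1\le j\le k$, and $N$ is contained in $M$: there are a unitary matrix $U$ and a unitary projective (co-)representation $N'$ with factor system $\omega$ (possibly of dimension $0$) such that $U^{-1}M(g)\kappa_{s(g)}U=\big(N(g)\oplus N'(g)\big)\kappa_{s(g)}$ for all $g\in G$. -/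

import Mathlib

/-- `κ_ε`: the identity of `ℂ` if `ε = 1`, complex conjugation if `ε = -1`. -/
noncomputable def kappa (ε : ℤˣ) : ℂ ≃ₐ[ℝ] ℂ :=
  if ε = 1 then AlgEquiv.refl else Complex.conjAe

theorem kappa_kappa (ε : ℤˣ) (z : ℂ) : kappa ε (kappa ε z) = z := by
  unfold kappa
  split_ifs <;> simp

theorem kappa_smul (ε : ℤˣ) (r : ℝ) (z : ℂ) : kappa ε (r • z) = r • kappa ε z := by
  unfold kappa
  split_ifs <;> simp

/-- A factor system of the group `G`, whose anti-unitary elements are the `g` with `s g = -1`: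
phases `ω(g₁, g₂)` with the twisted cocycle condition. -/
structure FactorSystem {G : Type*} [Group G] (s : G →* ℤˣ) where
  toFun : G → G → Circle
  cocycle : ∀ g₁ g₂ g₃ : G,
    toFun g₁ g₂ * toFun (g₁ * g₂) g₃ = toFun g₂ g₃ ^ (s g₁ : ℤ) * toFun g₁ (g₂ * g₃)

/-- A unitary projective (co-)representation of `G` with factor system `ω` on `ℂⁿ`:
unitary matrices `M(g)` with `M(g₁)κ_{s(g₁)} M(g₂)κ_{s(g₂)} = ω(g₁,g₂) M(g₁g₂)κ_{s(g₁g₂)}`. -/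
structure UnitaryCoRep {G : Type*} [Group G] {s : G →* ℤˣ} (ω : FactorSystem s)
    (n : Type*) [Fintype n] [DecidableEq n] where
  mat : G → Matrix n n ℂ
  unitary : ∀ g, mat g ∈ Matrix.unitaryGroup n ℂ
  mul_kappa : ∀ g₁ g₂,
    mat g₁ * (mat g₂).map (kappa (s g₁)) = (ω.toFun g₁ g₂ : ℂ) • mat (g₁ * g₂)

namespace UnitaryCoRep

variable {G : Type*} [Group G] {s : G →* ℤˣ} {ω : FactorSystem s}
  {n : Type*} [Fintype n] [DecidableEq n]

/-- The invertible (linear or antilinear) operator `M(g)κ_{s(g)}` on `ℂⁿ`. -/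
noncomputable def op (M : UnitaryCoRep ω n) (g : G) :
    EuclideanSpace ℂ n ≃ₗ[ℝ] EuclideanSpace ℂ n where
  toFun v := WithLp.toLp 2 (Matrix.mulVec (M.mat g) fun i => kappa (s g) (v i))
  invFun v := WithLp.toLp 2 fun i => kappa (s g) (Matrix.mulVec (M.mat g)⁻¹ v.ofLp i)
  map_add' v w := by
    ext i
    simp [Matrix.mulVec, dotProduct, mul_add, Finset.sum_add_distrib]
  map_smul' r v := by
    ext i
    simp only [Matrix.mulVec, dotProduct, PiLp.smul_apply, Finset.smul_sum, RingHom.id_apply]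
    exact Finset.sum_congr rfl fun j _ =>
      (congrArg (M.mat g i j * ·) (kappa_smul (s g) r (v j))).trans (mul_smul_comm _ _ _)
  left_inv v := by
    have h : IsUnit (M.mat g).det := Matrix.UnitaryGroup.det_isUnit ⟨_, M.unitary g⟩
    ext i
    simp [Matrix.mulVec_mulVec, Matrix.nonsing_inv_mul _ h, kappa_kappa]
  right_inv v := by
    have h : IsUnit (M.mat g).det := Matrix.UnitaryGroup.det_isUnit ⟨_, M.unitary g⟩
    ext i
    simp [Matrix.mulVec_mulVec, Matrix.mul_nonsing_inv _ h, kappa_kappa]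

/-- The matrix of the complex linear operator `[M(g)κ_{s(g)}] A [M(g)κ_{s(g)}]⁻¹`. -/
noncomputable def conjBy (M : UnitaryCoRep ω n) (g : G) (A : Matrix n n ℂ) : Matrix n n ℂ :=
  M.mat g * A.map (kappa (s g)) * (M.mat g)⁻¹

theorem conjBy_apply (M : UnitaryCoRep ω n) (g : G) (A : Matrix n n ℂ) (v : EuclideanSpace ℂ n) :
    Matrix.toEuclideanLin (M.conjBy g A) v =
      M.op g (Matrix.toEuclideanLin A ((M.op g).symm v)) := by
  ext i
  simp only [conjBy, op, Matrix.toLpLin_apply, LinearEquiv.coe_mk, LinearMap.coe_mk,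
    AddHom.coe_mk, LinearEquiv.coe_symm_mk, ← Matrix.mulVec_mulVec]
  congr 2
  funext j
  simp [Matrix.mulVec, dotProduct, kappa_kappa]

/-- `ℋ = ∑_g [M(g)κ_{s(g)}] (X + X†) [M(g)κ_{s(g)}]⁻¹`. -/
noncomputable def hamiltonian [Fintype G] (M : UnitaryCoRep ω n) (X : Matrix n n ℂ) :
    Matrix n n ℂ :=
  ∑ g : G, M.conjBy g (X + X.conjTranspose)

/-- `M` is irreducible: the space is nonzero and no complex subspace other than `0` and the
whole space is invariant under all `M(g)κ_{s(g)}`. -/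
def IsIrreducible (M : UnitaryCoRep ω n) : Prop :=
  Nonempty n ∧ ∀ W : Submodule ℂ (EuclideanSpace ℂ n),
    (∀ g, ∀ v ∈ W, M.op g v ∈ W) → W = ⊥ ∨ W = ⊤

/-- `N` is contained in `M`: for some unitary `U` and some unitary projective
(co-)representation `N'` with the same factor system (possibly of dimension `0`),
`U⁻¹ M(g)κ_{s(g)} U = (N(g) ⊕ N'(g))κ_{s(g)}` for all `g`. -/
def IsContainedIn {m : Type*} [Fintype m] [DecidableEq m]
    (N : UnitaryCoRep ω m) (M : UnitaryCoRep ω n) : Prop :=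
  ∃ (l : ℕ) (N' : UnitaryCoRep ω (Fin l)) (U : Matrix n (m ⊕ Fin l) ℂ),
    U.conjTranspose * U = 1 ∧ U * U.conjTranspose = 1 ∧
    ∀ g, M.mat g * U.map (kappa (s g)) = U * Matrix.fromBlocks (N.mat g) 0 0 (N'.mat g)

end UnitaryCoRep

/-! Averaging over `G` makes `ℋ_X` invariant, and every invariant Hermitian matrix is some `ℋ_Y`
(`exists_hamiltonian_eq`). Choose `X` so that `ℋ_X` has as many distinct eigenvalues as possible. If
an eigenspace had a proper nonzero invariant subspace `W`, the orthogonal projection onto `W` would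
be invariant too, and adding a suitable real multiple of it would move `W` to a new eigenvalue and
keep all the old ones, against maximality. So all eigenspaces are irreducible
(`eq_bot_or_eq_eigenspace_of_maximal`).

Maximality is generic: a Hermitian `A` has at least `r` eigenvalues iff the Gram determinant
`tracePowDet r A` is nonzero. This is a polynomial condition, which holds at some `X₀` for the
maximal `r`, hence fails at only finitely many points of each line in direction `X₀`, hence only on
a null set. -/

theorem kappa_mul (ε δ : ℤˣ) (z : ℂ) : kappa (ε * δ) z = kappa ε (kappa δ z) := by
  rcases Int.units_eq_one_or ε with rfl | rfl <;> rcases Int.units_eq_one_or δ with rfl | rfl <;>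
    simp [kappa]

theorem kappa_conj (ε : ℤˣ) (z : ℂ) : kappa ε (starRingEnd ℂ z) = starRingEnd ℂ (kappa ε z) := by
  rcases Int.units_eq_one_or ε with rfl | rfl <;> simp [kappa]

theorem kappa_ofReal (ε : ℤˣ) (r : ℝ) : kappa ε (r : ℂ) = r :=
  (kappa ε).commutes r

namespace UnitaryCoRep

/-! ### Semilinear operators, conjugation and averaging over `G` -/

section Operators

variable {G : Type*} [Group G] {s : G →* ℤˣ} {ω : FactorSystem s}
  {n : Type*} [Fintype n] [DecidableEq n] (M : UnitaryCoRep ω n)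

theorem op_apply (g : G) (v : EuclideanSpace ℂ n) (i : n) :
    M.op g v i = ∑ j, M.mat g i j * kappa (s g) (v j) := rfl

theorem op_smul (g : G) (c : ℂ) (v : EuclideanSpace ℂ n) :
    M.op g (c • v) = kappa (s g) c • M.op g v := by
  ext i
  simp only [op_apply, PiLp.smul_apply, smul_eq_mul, map_mul, Finset.mul_sum]
  exact Finset.sum_congr rfl fun j _ => by ring

theorem op_op (g h : G) (v : EuclideanSpace ℂ n) :
    M.op g (M.op h v) = (ω.toFun g h : ℂ) • M.op (g * h) v := by
  ext i
  have key (k : n) : ∑ j, M.mat g i j * kappa (s g) (M.mat h j k) =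
      (ω.toFun g h : ℂ) * M.mat (g * h) i k := by
    simpa [Matrix.mul_apply] using congrFun (congrFun (M.mul_kappa g h) i) k
  simp only [op_apply, PiLp.smul_apply, smul_eq_mul, map_sum, map_mul, Finset.mul_sum]
  rw [Finset.sum_comm]
  refine Finset.sum_congr rfl fun k _ => ?_
  rw [← mul_assoc, ← key, Finset.sum_mul, kappa_mul]
  exact Finset.sum_congr rfl fun j _ => by ring

theorem inner_op (g : G) (v w : EuclideanSpace ℂ n) :
    inner ℂ (M.op g v) (M.op g w) = kappa (s g) (inner ℂ v w) := by
  have h : (M.mat g).conjTranspose * M.mat g = 1 := Matrix.mem_unitaryGroup_iff'.1 (M.unitary g)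
  change dotProduct ((M.mat g).mulVec _) (star ((M.mat g).mulVec _)) = _
  rw [Matrix.star_mulVec, dotProduct_comm, ← Matrix.dotProduct_mulVec, Matrix.mulVec_mulVec, h,
    Matrix.one_mulVec, EuclideanSpace.inner_eq_star_dotProduct]
  simp only [dotProduct, map_sum, map_mul, Pi.star_apply, RCLike.star_def, kappa_conj]
  exact Finset.sum_congr rfl fun j _ => mul_comm _ _

theorem conjBy_apply_op (g : G) (A : Matrix n n ℂ) (v : EuclideanSpace ℂ n) :
    Matrix.toEuclideanLin (M.conjBy g A) (M.op g v) = M.op g (Matrix.toEuclideanLin A v) := by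
  rw [conjBy_apply, LinearEquiv.symm_apply_apply]

theorem conjBy_eq_iff (g : G) (A : Matrix n n ℂ) :
    M.conjBy g A = A ↔ ∀ v, Matrix.toEuclideanLin A (M.op g v) =
      M.op g (Matrix.toEuclideanLin A v) := by
  refine ⟨fun h v => by rw [← conjBy_apply_op, h], fun h => ?_⟩
  apply Matrix.toEuclideanLin.injective
  ext1 v
  rw [conjBy_apply, ← h, LinearEquiv.apply_symm_apply]

/-- The phase `ω(g, h)` cancels because the conjugated matrix is complex linear; conjugation is thus
a genuine action of `G`. -/
theorem conjBy_conjBy (g h : G) (A : Matrix n n ℂ) :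
    M.conjBy g (M.conjBy h A) = M.conjBy (g * h) A := by
  apply Matrix.toEuclideanLin.injective
  ext1 v
  obtain ⟨u, rfl⟩ := (M.op g).surjective v
  obtain ⟨w, rfl⟩ := (M.op h).surjective u
  rw [conjBy_apply_op, conjBy_apply_op, op_op, op_op, map_smul, conjBy_apply_op]

theorem conjBy_add (g : G) (A B : Matrix n n ℂ) :
    M.conjBy g (A + B) = M.conjBy g A + M.conjBy g B := by
  simp only [conjBy, Matrix.map_add _ (map_add (kappa (s g))), mul_add, add_mul]

theorem conjBy_real_smul (g : G) (c : ℝ) (A : Matrix n n ℂ) :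
    M.conjBy g (c • A) = c • M.conjBy g A := by
  have : (c • A).map (kappa (s g)) = c • A.map (kappa (s g)) := by
    ext i j
    simp [kappa_ofReal]
  simp only [conjBy, this, Matrix.mul_smul, Matrix.smul_mul]

theorem conjBy_sum {ι : Type*} (t : Finset ι) (g : G) (A : ι → Matrix n n ℂ) :
    M.conjBy g (∑ i ∈ t, A i) = ∑ i ∈ t, M.conjBy g (A i) :=
  map_sum (AddMonoidHom.mk' (M.conjBy g) (M.conjBy_add g)) A t

theorem conjBy_isHermitian (g : G) {A : Matrix n n ℂ} (hA : A.IsHermitian) :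
    (M.conjBy g A).IsHermitian := by
  have hinv : (M.mat g)⁻¹ = (M.mat g).conjTranspose :=
    Matrix.inv_eq_left_inv (Matrix.mem_unitaryGroup_iff'.1 (M.unitary g))
  have hmap : (A.map (kappa (s g))).IsHermitian := by
    ext i j
    simp only [Matrix.conjTranspose_apply, Matrix.map_apply, RCLike.star_def, ← kappa_conj]
    rw [← hA.apply i j, RCLike.star_def]
  rw [conjBy, hinv]
  exact Matrix.isHermitian_mul_mul_conjTranspose _ hmap

variable [Fintype G]

theorem hamiltonian_isHermitian (X : Matrix n n ℂ) : (M.hamiltonian X).IsHermitian := by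
  rw [hamiltonian, Matrix.IsHermitian, Matrix.conjTranspose_sum]
  exact Finset.sum_congr rfl fun g _ =>
    M.conjBy_isHermitian g (Matrix.isHermitian_add_transpose_self X)

theorem conjBy_hamiltonian (g : G) (X : Matrix n n ℂ) :
    M.conjBy g (M.hamiltonian X) = M.hamiltonian X := by
  simp only [hamiltonian, conjBy_sum, conjBy_conjBy]
  exact Fintype.sum_equiv (Equiv.mulLeft g) _ _ fun _ => rfl

theorem hamiltonian_apply_op (X : Matrix n n ℂ) (g : G) (v : EuclideanSpace ℂ n) :
    Matrix.toEuclideanLin (M.hamiltonian X) (M.op g v) =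
      M.op g (Matrix.toEuclideanLin (M.hamiltonian X) v) :=
  (M.conjBy_eq_iff g _).1 (M.conjBy_hamiltonian g X) v

theorem hamiltonian_add (X Y : Matrix n n ℂ) :
    M.hamiltonian (X + Y) = M.hamiltonian X + M.hamiltonian Y := by
  simp only [hamiltonian, ← Finset.sum_add_distrib, ← conjBy_add, Matrix.conjTranspose_add]
  exact Finset.sum_congr rfl fun g _ => by congr 1; abel

theorem hamiltonian_real_smul (c : ℝ) (X : Matrix n n ℂ) :
    M.hamiltonian (c • X) = c • M.hamiltonian X := by
  simp only [hamiltonian, Finset.smul_sum, ← conjBy_real_smul, Matrix.conjTranspose_smul,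
    smul_add, star_trivial]

theorem exists_hamiltonian_eq {H : Matrix n n ℂ} (hH : H.IsHermitian)
    (hinv : ∀ g, M.conjBy g H = H) : ∃ X, M.hamiltonian X = H := by
  -- Each of the `|G|` summands for `H` itself equals `H + H† = 2H`.
  refine ⟨(2 * Fintype.card G : ℝ)⁻¹ • H, ?_⟩
  have hcard : (Fintype.card G : ℝ) ≠ 0 := by simp
  rw [hamiltonian_real_smul, hamiltonian, hH.eq]
  simp only [conjBy_add, hinv, Finset.sum_const, Finset.card_univ]
  rw [← two_smul ℝ H, ← Nat.cast_smul_eq_nsmul ℝ, smul_smul, smul_smul]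
  convert one_smul ℝ H using 2
  field_simp

end Operators

/-! ### Invariant subspaces, complements and subrepresentations -/

section Restriction

variable {G : Type*} [Group G] {s : G →* ℤˣ} {ω : FactorSystem s}
  {n : Type*} [Fintype n] [DecidableEq n] (M : UnitaryCoRep ω n)

/-- A subspace invariant under all operators `M(g)κ_{s(g)}`. -/
def IsInvariant (W : Submodule ℂ (EuclideanSpace ℂ n)) : Prop :=
  ∀ g, ∀ v ∈ W, M.op g v ∈ W

variable {M} {W : Submodule ℂ (EuclideanSpace ℂ n)}

/-- An injective map of `W` into itself is onto. Dimensions are counted over `ℝ`, as the operator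
may be antilinear. -/
theorem IsInvariant.exists_op_eq (hW : M.IsInvariant W) (g : G) {w : EuclideanSpace ℂ n}
    (hw : w ∈ W) : ∃ u ∈ W, M.op g u = w := by
  let W' : Submodule ℝ (EuclideanSpace ℂ n) := W.restrictScalars ℝ
  have hle : W'.map (M.op g).toLinearMap ≤ W' := by
    rintro _ ⟨v, hv, rfl⟩
    exact hW g v hv
  have heq := Submodule.eq_of_le_of_finrank_eq hle (LinearEquiv.finrank_map_eq (M.op g) W')
  exact heq.ge hw

theorem IsInvariant.orthogonal (hW : M.IsInvariant W) : M.IsInvariant Wᗮ := by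
  intro g v hv w hw
  obtain ⟨u, hu, rfl⟩ := hW.exists_op_eq g hw
  rw [inner_op, hv u hu, map_zero]

theorem IsInvariant.starProjection_op (hW : M.IsInvariant W) (g : G) (v : EuclideanSpace ℂ n) :
    W.starProjection (M.op g v) = M.op g (W.starProjection v) := by
  refine Submodule.eq_starProjection_of_mem_orthogonal
    (hW g _ (Submodule.starProjection_apply_mem W v)) ?_
  rw [← map_sub]
  exact hW.orthogonal g _ (Submodule.sub_starProjection_mem_orthogonal v)

variable {m : Type*} [Fintype m]

theorem IsInvariant.sum_inner_smul (hW : M.IsInvariant W) (b : OrthonormalBasis m ℂ W) (g : G)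
    {v : EuclideanSpace ℂ n} (hv : v ∈ W) :
    ∑ i, inner ℂ (b i : EuclideanSpace ℂ n) (M.op g v) • (b i : EuclideanSpace ℂ n) =
      M.op g v := by
  simpa using congrArg Subtype.val (b.sum_repr' ⟨M.op g v, hW g v hv⟩)

variable [DecidableEq m]

/-- The (co-)representation on an invariant subspace, in an orthonormal basis of it. -/
noncomputable def IsInvariant.restrict (hW : M.IsInvariant W) (b : OrthonormalBasis m ℂ W) :
    UnitaryCoRep ω m where
  mat g := Matrix.of fun i j => inner ℂ (b i : EuclideanSpace ℂ n) (M.op g (b j))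
  unitary g := by
    rw [Matrix.mem_unitaryGroup_iff']
    ext j k
    have h := b.sum_inner_mul_inner ⟨M.op g (b j), hW g _ (b j).2⟩ ⟨M.op g (b k), hW g _ (b k).2⟩
    simp only [Submodule.coe_inner, inner_op] at h
    simp only [Matrix.star_eq_conjTranspose, Matrix.mul_apply, Matrix.conjTranspose_apply,
      Matrix.of_apply, RCLike.star_def, inner_conj_symm, h, ← Submodule.coe_inner,
      orthonormal_iff_ite.1 b.orthonormal j k, Matrix.one_apply]
    split_ifs <;> simp
  mul_kappa g h := by
    ext i k
    have key := congrArg (fun v => inner ℂ (b i : EuclideanSpace ℂ n) (M.op g v))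
      (hW.sum_inner_smul b h (b k).2)
    simp only [map_sum, op_smul, inner_sum, inner_smul_right, op_op] at key
    simp only [Matrix.mul_apply, Matrix.of_apply, Matrix.map_apply, Matrix.smul_apply, smul_eq_mul,
      ← key]
    exact Finset.sum_congr rfl fun j _ => mul_comm _ _

theorem IsInvariant.op_basis (hW : M.IsInvariant W) (b : OrthonormalBasis m ℂ W) (g : G) (j : m) :
    M.op g (b j : EuclideanSpace ℂ n) =
      ∑ i, (hW.restrict b).mat g i j • (b i : EuclideanSpace ℂ n) :=
  (hW.sum_inner_smul b g (b j).2).symm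

theorem IsInvariant.op_repr_symm (hW : M.IsInvariant W) (b : OrthonormalBasis m ℂ W) (g : G)
    (x : EuclideanSpace ℂ m) :
    M.op g (b.repr.symm x : EuclideanSpace ℂ n) = b.repr.symm ((hW.restrict b).op g x) := by
  simp only [← b.sum_repr_symm, Submodule.coe_sum, Submodule.coe_smul, map_sum, op_smul,
    hW.op_basis b, op_apply, Finset.smul_sum, Finset.sum_smul, smul_smul]
  rw [Finset.sum_comm]
  exact Finset.sum_congr rfl fun i _ => Finset.sum_congr rfl fun j _ => by rw [mul_comm]

theorem IsInvariant.restrict_isIrreducible (hW : M.IsInvariant W) (b : OrthonormalBasis m ℂ W)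
    (hbot : W ≠ ⊥) (hirr : ∀ V ≤ W, M.IsInvariant V → V = ⊥ ∨ V = W) :
    (hW.restrict b).IsIrreducible := by
  constructor
  · by_contra hm
    rw [not_nonempty_iff] at hm
    apply hbot
    rw [Submodule.eq_bot_iff]
    intro w hw
    have : b.repr ⟨w, hw⟩ = 0 := Subsingleton.elim _ _
    simpa using this
  · intro V hV
    let f : EuclideanSpace ℂ m →ₗ[ℂ] EuclideanSpace ℂ n :=
      W.subtype ∘ₗ b.repr.symm.toLinearEquiv.toLinearMap
    have hf : Function.Injective f := W.injective_subtype.comp b.repr.symm.injective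
    have hop (g : G) (x : EuclideanSpace ℂ m) : M.op g (f x) = f ((hW.restrict b).op g x) :=
      hW.op_repr_symm b g x
    have hle : V.map f ≤ W := by
      rintro _ ⟨x, -, rfl⟩
      exact (b.repr.symm x).2
    have hinv : M.IsInvariant (V.map f) := by
      rintro g _ ⟨x, hx, rfl⟩
      exact ⟨_, hV g x hx, (hop g x).symm⟩
    refine (hirr _ hle hinv).imp (fun h => ?_) (fun h => ?_)
    · rw [Submodule.eq_bot_iff]
      intro x hx
      apply hf
      rw [map_zero]
      exact (Submodule.eq_bot_iff _).1 h _ ⟨x, hx, rfl⟩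
    · rw [eq_top_iff]
      intro x _
      obtain ⟨y, hy, hyx⟩ := h.ge (b.repr.symm x).2
      exact hf hyx ▸ hy

theorem IsInvariant.restrict_isContainedIn (hW : M.IsInvariant W) (b : OrthonormalBasis m ℂ W) :
    (hW.restrict b).IsContainedIn M := by
  -- `N'` is the restriction to `Wᗮ`; the columns of `U` are the two orthonormal bases.
  let c := stdOrthonormalBasis ℂ Wᗮ
  let u : m ⊕ Fin (Module.finrank ℂ Wᗮ) → EuclideanSpace ℂ n :=
    Sum.elim (fun j => b j) (fun j => c j)
  let U : Matrix n (m ⊕ Fin (Module.finrank ℂ Wᗮ)) ℂ := Matrix.of fun i j => u j i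
  have hu (j k) : inner ℂ (u j) (u k) = if j = k then (1 : ℂ) else 0 := by
    rcases j with j | j <;> rcases k with k | k
    · simpa [u] using orthonormal_iff_ite.1 b.orthonormal j k
    · simpa [u] using Submodule.inner_right_of_mem_orthogonal (b j).2 (c k).2
    · simpa [u] using Submodule.inner_left_of_mem_orthogonal (b k).2 (c j).2
    · simpa [u] using orthonormal_iff_ite.1 c.orthonormal j k
  have hU : U.conjTranspose * U = 1 := by
    ext j k
    rw [Matrix.one_apply, ← hu, EuclideanSpace.inner_eq_star_dotProduct, dotProduct_comm]
    rfl
  have hcard : Fintype.card (m ⊕ Fin (Module.finrank ℂ Wᗮ)) = Fintype.card n := by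
    rw [Fintype.card_sum, Fintype.card_fin, ← Module.finrank_eq_card_basis b.toBasis,
      Submodule.finrank_add_finrank_orthogonal, finrank_euclideanSpace]
  refine ⟨_, hW.orthogonal.restrict c, U, hU,
    (Matrix.mul_eq_one_comm_of_card_eq _ _ _ hcard).1 hU, fun g => ?_⟩
  ext i j
  change M.op g (u j) i = _
  rcases j with j | j
  · change M.op g (b j) i = _
    simp [hW.op_basis b, Matrix.mul_apply, U, u, mul_comm]
  · change M.op g (c j) i = _
    simp [hW.orthogonal.op_basis c, Matrix.mul_apply, U, u, mul_comm]

end Restriction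

end UnitaryCoRep
-- Counting eigenvalues by a Gram determinant
namespace Matrix

/-- Over `ℝ`, `VᵀV` and `V` have the same kernel: the polynomials of degree below `r` vanishing at
every `v i`. -/
theorem det_transpose_mul_self_vandermonde_ne_zero_iff {n : Type*} [Fintype n] (v : n → ℝ)
    (r : ℕ) :
    ((of fun (i : n) (j : Fin r) => v i ^ (j : ℕ))ᵀ *
      (of fun (i : n) (j : Fin r) => v i ^ (j : ℕ))).det ≠ 0 ↔ r ≤ (Set.range v).ncard := by
  classical
  set V : Matrix n (Fin r) ℝ := of fun i j => v i ^ (j : ℕ)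
  have hdet : (Vᵀ * V).det ≠ 0 ↔ ∀ c, V *ᵥ c = 0 → c = 0 := by
    rw [ne_eq, ← exists_mulVec_eq_zero_iff]
    push Not
    refine forall_congr' fun c => ?_
    have : (Vᵀ * V) *ᵥ c = 0 ↔ V *ᵥ c = 0 := by
      simpa only [LinearMap.mem_ker, mulVecLin_apply] using
        SetLike.ext_iff.1 (ker_mulVecLin_transpose_mul_self V) c
    rw [← this]
    tauto
  have hcard : (Set.range v).ncard = (Finset.univ.image v).card := by
    rw [← Set.ncard_coe_finset]
    simp
  rw [hdet, hcard]
  constructor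
  · intro h
    by_contra! hlt
    set t := Finset.univ.image v
    -- With fewer than `r` values, this monic polynomial gives a nonzero kernel vector.
    let p : Polynomial ℝ := ∏ x ∈ t, (Polynomial.X - Polynomial.C x)
    have hp : p.Monic := Polynomial.monic_prod_X_sub_C _ _
    have hpd : p.natDegree = t.card := by simp [p]
    have hc := h (fun j => p.coeff j) (by
      ext i
      have h0 : p.eval (v i) = 0 := by
        rw [Polynomial.eval_prod]
        exact Finset.prod_eq_zero (Finset.mem_image_of_mem v (Finset.mem_univ i)) (by simp)
      rw [Polynomial.eval_eq_sum_range' (hpd.trans_lt hlt), Finset.sum_range] at h0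
      simpa [V, mulVec, dotProduct, mul_comm] using h0)
    have : p.coeff p.natDegree = 0 := hpd ▸ congrFun hc ⟨t.card, hlt⟩
    exact one_ne_zero (hp.coeff_natDegree.symm.trans this)
  · intro h c hc
    -- Rows at `r` distinct values form an invertible square Vandermonde matrix.
    obtain ⟨t, ht, htr⟩ := Finset.exists_subset_card_eq h
    let e := t.equivFinOfCardEq htr
    have hex (j : Fin r) : ∃ i, v i = e.symm j := by
      simpa using ht (e.symm j).2
    choose f hf using hex
    have hinj : Function.Injective (v ∘ f) := by
      intro j k hjk
      simp only [Function.comp_apply, hf] at hjk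
      exact e.symm.injective (Subtype.ext hjk)
    refine eq_zero_of_mulVec_eq_zero (det_vandermonde_ne_zero_iff.2 hinj) ?_
    ext j
    exact congrFun hc (f j)

variable {n : Type*} [Fintype n] [DecidableEq n]

theorem IsHermitian.trace_pow_eq_sum_eigenvalues {A : Matrix n n ℂ} (hA : A.IsHermitian) (k : ℕ) :
    (A ^ k).trace = ∑ i, (hA.eigenvalues i : ℂ) ^ k := by
  conv_lhs => rw [hA.spectral_theorem, ← map_pow, Unitary.conjStarAlgAut_apply, trace_mul_cycle,
    Unitary.coe_star_mul_self, one_mul, diagonal_pow, trace_diagonal]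
  simp

/-- The Gram determinant of `1, A, …, A ^ (r - 1)` for the bilinear form `tr (A * B)`. -/
noncomputable def tracePowDet (r : ℕ) (A : Matrix n n ℂ) : ℂ :=
  (of fun i j : Fin r => (A ^ (i + j : ℕ)).trace).det

/-- The trace of `A ^ (i + j)` is a power sum of the eigenvalues, so the matrix is `VᵀV` for their
Vandermonde matrix `V`. -/
theorem IsHermitian.tracePowDet_ne_zero_iff {A : Matrix n n ℂ} (hA : A.IsHermitian) (r : ℕ) :
    tracePowDet r A ≠ 0 ↔ r ≤ (spectrum ℝ A).ncard := by
  rw [hA.spectrum_real_eq_range_eigenvalues, ← det_transpose_mul_self_vandermonde_ne_zero_iff,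
    tracePowDet]
  rw [← Complex.ofReal_ne_zero, ← Complex.ofRealHom_eq_coe, RingHom.map_det]
  refine iff_of_eq (congrArg (fun B : Matrix _ _ ℂ => B.det ≠ 0) ?_)
  ext i j
  rw [of_apply, hA.trace_pow_eq_sum_eigenvalues]
  simp [mul_apply, pow_add]

theorem continuous_tracePowDet (r : ℕ) :
    Continuous (tracePowDet r : Matrix n n ℂ → ℂ) := by
  refine Continuous.matrix_det (continuous_matrix fun i j => ?_)
  exact (continuous_id.pow _).matrix_trace

theorem tracePowDet_smul (r : ℕ) (c : ℂ) (A : Matrix n n ℂ) :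
    tracePowDet r (c • A) = (∏ i : Fin r, c ^ (i : ℕ)) ^ 2 * tracePowDet r A := by
  have : (of fun i j : Fin r => ((c • A) ^ (i + j : ℕ)).trace) =
      diagonal (fun i : Fin r => c ^ (i : ℕ)) * (of fun i j : Fin r => (A ^ (i + j : ℕ)).trace) *
        diagonal (fun i : Fin r => c ^ (i : ℕ)) := by
    ext i j
    rw [mul_diagonal, diagonal_mul, of_apply, of_apply, smul_pow, trace_smul, smul_eq_mul, pow_add]
    ring
  rw [tracePowDet, this, det_mul, det_mul, det_diagonal, tracePowDet]
  ring

open Polynomial in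
theorem exists_polynomial_eval_eq_tracePowDet (r : ℕ) (A B : Matrix n n ℂ) :
    ∃ p : ℂ[X], ∀ t : ℂ, p.eval t = tracePowDet r (t • A + B) := by
  let P : Matrix n n ℂ[X] := (X : ℂ[X]) • A.map C + B.map C
  refine ⟨(of fun i j : Fin r => (P ^ (i + j : ℕ)).trace).det, fun t => ?_⟩
  have hP : (evalRingHom t).mapMatrix P = t • A + B := by
    ext i j
    simp [P]
    ring
  rw [← coe_evalRingHom, RingHom.map_det, tracePowDet]
  congr 1
  ext i j
  rw [RingHom.mapMatrix_apply, map_apply, of_apply, of_apply, ← hP, ← map_pow]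
  simp only [Matrix.trace, diag_apply, map_apply, map_sum, coe_evalRingHom, RingHom.mapMatrix_apply]

/-- On a line in a direction `B` at which `tracePowDet` does not vanish, it has finitely many
zeros. -/
theorem finite_setOf_tracePowDet_eq_zero {r : ℕ} {B : Matrix n n ℂ} (hB : tracePowDet r B ≠ 0)
    (A : Matrix n n ℂ) : {t : ℝ | tracePowDet r (A + (t : ℂ) • B) = 0}.Finite := by
  obtain ⟨p, hp⟩ := exists_polynomial_eval_eq_tracePowDet r A B
  have hp0 : p ≠ 0 := by
    rintro rfl
    exact hB (by simpa using (hp 0).symm)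
  -- By homogeneity, a zero `t ≠ 0` on the line makes `t⁻¹` a root of `p`, and `p(0)` is the value
  -- at `B`.
  have hfin : ((fun t : ℝ => ((t⁻¹ : ℝ) : ℂ)) ⁻¹' {z | p.IsRoot z}).Finite :=
    (Polynomial.finite_setOfPred_isRoot hp0).preimage
      (Complex.ofReal_injective.comp inv_injective).injOn
  refine (hfin.insert 0).subset fun t ht => ?_
  by_cases h0 : t = 0
  · exact Or.inl h0
  · right
    have h0' : (t : ℂ) ≠ 0 := Complex.ofReal_ne_zero.2 h0
    have hs : ((t⁻¹ : ℝ) : ℂ) • A + B = (t : ℂ)⁻¹ • (A + (t : ℂ) • B) := by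
      rw [smul_add, smul_smul, inv_mul_cancel₀ h0', one_smul, Complex.ofReal_inv]
    change p.eval _ = 0
    rw [hp, hs, tracePowDet_smul, show tracePowDet r _ = 0 from ht, mul_zero]

end Matrix
-- Splitting an eigenvalue
namespace Matrix

variable {n : Type*} [Fintype n] [DecidableEq n]

theorem hasEigenvalue_toEuclideanLin_ofReal_iff (A : Matrix n n ℂ) (x : ℝ) :
    Module.End.HasEigenvalue (toEuclideanLin A) (x : ℂ) ↔ x ∈ spectrum ℝ A := by
  rw [Module.End.hasEigenvalue_iff_mem_spectrum, spectrum_toLpLin,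
    ← spectrum.algebraMap_mem_iff ℂ]
  rfl

theorem mem_spectrum_real_of_toEuclideanLin_apply_eq {A : Matrix n n ℂ} {x : ℝ}
    {v : EuclideanSpace ℂ n} (hv : v ≠ 0) (h : toEuclideanLin A v = (x : ℂ) • v) :
    x ∈ spectrum ℝ A :=
  (hasEigenvalue_toEuclideanLin_ofReal_iff A x).1 <|
    Module.End.hasEigenvalue_of_hasEigenvector
      (Module.End.hasEigenvector_iff.2 ⟨Module.End.mem_eigenspace_iff.2 h, hv⟩)

/-- Shifting a Hermitian matrix on a proper nonzero subspace of an eigenspace splits the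
eigenvalue. -/
theorem IsHermitian.exists_ncard_spectrum_lt {A : Matrix n n ℂ} (hA : A.IsHermitian) {x : ℝ}
    {W : Submodule ℂ (EuclideanSpace ℂ n)}
    (hle : W ≤ Module.End.eigenspace (toEuclideanLin A) (x : ℂ)) (hbot : W ≠ ⊥)
    (hne : W ≠ Module.End.eigenspace (toEuclideanLin A) (x : ℂ)) :
    ∃ ε : ℝ, (spectrum ℝ A).ncard <
      (spectrum ℝ (A + ε • toEuclideanLin.symm W.starProjection.toLinearMap)).ncard := by
  -- The shift by `y - x` moves `W` from `x` to the unused value `y`.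
  obtain ⟨y, hy⟩ := (finite_real_spectrum (A := A)).exists_notMem
  refine ⟨y - x, ?_⟩
  set B := A + (y - x) • toEuclideanLin.symm W.starProjection.toLinearMap
  have hB (v : EuclideanSpace ℂ n) : toEuclideanLin B v =
      toEuclideanLin A v + ((y - x : ℝ) : ℂ) • W.starProjection v := by
    have : B = A + ((y - x : ℝ) : ℂ) • toEuclideanLin.symm W.starProjection.toLinearMap := by
      rw [Complex.coe_smul]
    rw [this, map_add, map_smul, LinearEquiv.apply_symm_apply]
    rfl
  have horth {v : EuclideanSpace ℂ n} (hv : v ∈ Wᗮ) : toEuclideanLin B v = toEuclideanLin A v := by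
    rw [hB, (Submodule.starProjection_apply_eq_zero_iff (K := W)).2 hv, smul_zero, add_zero]
  have hy' : y ∈ spectrum ℝ B := by
    obtain ⟨w, hw, hw0⟩ := Submodule.exists_mem_ne_zero_of_ne_bot hbot
    refine mem_spectrum_real_of_toEuclideanLin_apply_eq hw0 ?_
    rw [hB, Submodule.starProjection_eq_self_iff.2 hw, Module.End.mem_eigenspace_iff.1 (hle hw),
      ← add_smul]
    simp
  have hsub : spectrum ℝ A ⊆ spectrum ℝ B := by
    intro z hz
    by_cases hzx : z = x
    · subst hzx
      -- The eigenvalue `x` survives on the part of its eigenspace orthogonal to `W`.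
      obtain ⟨v, hv, hvW⟩ := SetLike.exists_of_lt (lt_of_le_of_ne hle hne)
      have hmem := Submodule.starProjection_apply_mem W v
      refine mem_spectrum_real_of_toEuclideanLin_apply_eq (v := v - W.starProjection v) ?_ ?_
      · intro h0
        rw [sub_eq_zero] at h0
        exact hvW (h0 ▸ hmem)
      · rw [horth (Submodule.sub_starProjection_mem_orthogonal v)]
        exact Module.End.mem_eigenspace_iff.1 (Submodule.sub_mem _ hv (hle hmem))
    · obtain ⟨v, hv⟩ :=
        ((hasEigenvalue_toEuclideanLin_ofReal_iff A z).2 hz).exists_hasEigenvector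
      refine mem_spectrum_real_of_toEuclideanLin_apply_eq hv.2 ?_
      rw [horth, hv.apply_eq_smul]
      intro w hw
      exact (isSymmetric_toEuclideanLin_iff.2 hA).orthogonalFamily_eigenspaces
        (i := (x : ℂ)) (j := (z : ℂ)) (by exact_mod_cast Ne.symm hzx) ⟨w, hle hw⟩ ⟨v, hv.1⟩
  exact Set.ncard_lt_ncard (Set.ssubset_iff_of_subset hsub |>.2 ⟨y, hy', hy⟩) finite_real_spectrum

end Matrix

/-! ### Irreducible eigenspaces and genericity -/

namespace UnitaryCoRep

variable {G : Type*} [Group G] {s : G →* ℤˣ} {ω : FactorSystem s}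
  {n : Type*} [Fintype n] [DecidableEq n] {M : UnitaryCoRep ω n}

/-- A real eigenvalue is needed: an antilinear operator conjugates the scalar. -/
theorem isInvariant_eigenspace {A : Matrix n n ℂ} (hA : ∀ g, M.conjBy g A = A) (x : ℝ) :
    M.IsInvariant (Module.End.eigenspace (Matrix.toEuclideanLin A) (x : ℂ)) := by
  intro g v hv
  rw [Module.End.mem_eigenspace_iff] at hv ⊢
  rw [(M.conjBy_eq_iff g A).1 (hA g), hv, op_smul, kappa_ofReal]

theorem IsInvariant.conjBy_starProjection {W : Submodule ℂ (EuclideanSpace ℂ n)}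
    (hW : M.IsInvariant W) (g : G) :
    M.conjBy g (Matrix.toEuclideanLin.symm W.starProjection.toLinearMap) =
      Matrix.toEuclideanLin.symm W.starProjection.toLinearMap := by
  rw [conjBy_eq_iff]
  simp only [LinearEquiv.apply_symm_apply]
  exact hW.starProjection_op g

variable [Fintype G]

/-- If the number of eigenvalues of `ℋ_X` is maximal, the eigenspaces have no proper invariant
subspaces. -/
theorem eq_bot_or_eq_eigenspace_of_maximal {X : Matrix n n ℂ}
    (hmax : ∀ Y, (spectrum ℝ (M.hamiltonian Y)).ncard ≤ (spectrum ℝ (M.hamiltonian X)).ncard)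
    {x : ℝ} {W : Submodule ℂ (EuclideanSpace ℂ n)}
    (hle : W ≤ Module.End.eigenspace (Matrix.toEuclideanLin (M.hamiltonian X)) (x : ℂ))
    (hW : M.IsInvariant W) :
    W = ⊥ ∨ W = Module.End.eigenspace (Matrix.toEuclideanLin (M.hamiltonian X)) (x : ℂ) := by
  by_contra! h
  obtain ⟨ε, hε⟩ := (M.hamiltonian_isHermitian X).exists_ncard_spectrum_lt hle h.1 h.2
  have hP : (Matrix.toEuclideanLin.symm W.starProjection.toLinearMap).IsHermitian := by
    rw [← Matrix.isSymmetric_toEuclideanLin_iff, LinearEquiv.apply_symm_apply]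
    exact Submodule.starProjection_isSymmetric (K := W)
  obtain ⟨Y, hY⟩ := M.exists_hamiltonian_eq
    ((M.hamiltonian_isHermitian X).add (hP.smul (IsSelfAdjoint.all ε))) fun g => by
      rw [conjBy_add, conjBy_real_smul, conjBy_hamiltonian, hW.conjBy_starProjection]
  exact (hmax Y).not_gt (hY ▸ hε)

theorem continuous_hamiltonian : Continuous M.hamiltonian := by
  have hκ (ε : ℤˣ) : Continuous (kappa ε) := (kappa ε).toLinearMap.continuous_of_finiteDimensional
  refine continuous_finsetSum _ fun g _ => ?_
  exact (continuous_const.matrix_mul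
    ((continuous_id.add continuous_id.matrix_conjTranspose).matrix_map (hκ _))).matrix_mul
      continuous_const

variable (M) in
open MeasureTheory in
theorem ae_forall_ncard_spectrum_hamiltonian_le :
    ∀ᵐ X : n → n → ℂ ∂volume, ∀ Y, (spectrum ℝ (M.hamiltonian Y)).ncard ≤
      (spectrum ℝ (M.hamiltonian (Matrix.of X))).ncard := by
  have hbdd : BddAbove (Set.range fun Y => (spectrum ℝ (M.hamiltonian Y)).ncard) := by
    refine ⟨Fintype.card n, ?_⟩
    rintro _ ⟨Y, rfl⟩
    beta_reduce
    rw [(M.hamiltonian_isHermitian Y).spectrum_real_eq_range_eigenvalues, ← Set.image_univ]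
    exact (Set.ncard_image_le Set.finite_univ).trans (by simp [Set.ncard_univ])
  obtain ⟨X₀, hX₀⟩ := Nat.sSup_mem (Set.range_nonempty _) hbdd
  have hmax (Y) : (spectrum ℝ (M.hamiltonian Y)).ncard ≤ (spectrum ℝ (M.hamiltonian X₀)).ncard :=
    (le_csSup hbdd ⟨Y, rfl⟩).trans_eq hX₀.symm
  set r := (spectrum ℝ (M.hamiltonian X₀)).ncard
  have h₀ : Matrix.tracePowDet r (M.hamiltonian X₀) ≠ 0 :=
    ((M.hamiltonian_isHermitian X₀).tracePowDet_ne_zero_iff r).2 le_rfl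
  let S : Set (n → n → ℂ) := {X | Matrix.tracePowDet r (M.hamiltonian (Matrix.of X)) ≠ 0}
  have hS : IsOpen S :=
    ((Matrix.continuous_tracePowDet r).comp continuous_hamiltonian).isOpen_preimage _
      isOpen_compl_singleton
  have : (volume : Measure (n → n → ℂ)).IsAddHaarMeasure :=
    Measure.pi.isAddHaarMeasure fun _ : n => (volume : Measure (n → ℂ))
  have hae : ∀ᵐ X ∂(volume : Measure (n → n → ℂ)), X ∈ S := by
    -- Fubini along lines parallel to `X₀`: each meets the complement of `S` in a finite set.
    refine ae_mem_of_ae_add_linearMap_mem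
      (LinearMap.toSpanSingleton ℝ (n → n → ℂ) (Matrix.of.symm X₀)) volume volume
      hS.measurableSet fun X => ?_
    refine (Set.Finite.subset (Matrix.finite_setOf_tracePowDet_eq_zero h₀
      (M.hamiltonian (Matrix.of X))) fun t ht => ?_).measure_zero volume
    have hlin : M.hamiltonian (Matrix.of (X + t • Matrix.of.symm X₀)) =
        M.hamiltonian (Matrix.of X) + (t : ℂ) • M.hamiltonian X₀ := by
      rw [Complex.coe_smul, ← hamiltonian_real_smul, ← hamiltonian_add]
      rfl
    change Matrix.tracePowDet r _ = 0
    rw [← hlin]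
    exact not_not.1 ht
  filter_upwards [hae] with X hX Y
  exact (hmax Y).trans (((M.hamiltonian_isHermitian _).tracePowDet_ne_zero_iff r).1 hX)

end UnitaryCoRep

theorem theorem1 {G : Type*} [Group G] [Fintype G] (s : G →* ℤˣ) (ω : FactorSystem s)
    (d : ℕ) (M : UnitaryCoRep ω (Fin d)) :
    (∀ X : Matrix (Fin d) (Fin d) ℂ,
      (M.hamiltonian X).IsHermitian ∧
      ∀ (g : G) (v : EuclideanSpace ℂ (Fin d)),
        Matrix.toEuclideanLin (M.hamiltonian X) (M.op g v) =
          M.op g (Matrix.toEuclideanLin (M.hamiltonian X) v)) ∧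
    ∀ᵐ X : Fin d → Fin d → ℂ ∂MeasureTheory.volume,
      ∀ μ : ℂ,
        Module.End.HasEigenvalue (Matrix.toEuclideanLin (M.hamiltonian (Matrix.of X))) μ →
        ∀ (k : ℕ) (b : OrthonormalBasis (Fin k) ℂ
            (Module.End.eigenspace (Matrix.toEuclideanLin (M.hamiltonian (Matrix.of X))) μ)),
          ∃ N : UnitaryCoRep ω (Fin k),
            (∀ (g : G) (j : Fin k),
              M.op g (b j : EuclideanSpace ℂ (Fin d)) =
                ∑ i, N.mat g i j • (b i : EuclideanSpace ℂ (Fin d))) ∧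
            N.IsIrreducible ∧ N.IsContainedIn M := by
  refine ⟨fun X => ⟨M.hamiltonian_isHermitian X, M.hamiltonian_apply_op X⟩, ?_⟩
  filter_upwards [M.ae_forall_ncard_spectrum_hamiltonian_le] with X hX μ hμ k b
  obtain ⟨x, rfl⟩ : ∃ x : ℝ, μ = x :=
    ⟨μ.re, (Complex.conj_eq_iff_re.1 ((Matrix.isSymmetric_toEuclideanLin_iff.2
      (M.hamiltonian_isHermitian _)).conj_eigenvalue_eq_self hμ)).symm⟩
  have hinv := UnitaryCoRep.isInvariant_eigenspace
    (fun g => M.conjBy_hamiltonian g (Matrix.of X)) x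
  exact ⟨hinv.restrict b, hinv.op_basis b,
    hinv.restrict_isIrreducible b hμ fun V hVW hV =>
      UnitaryCoRep.eq_bot_or_eq_eigenspace_of_maximal hX hVW hV,
    hinv.restrict_isContainedIn b⟩
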